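/- There is an absolute constant $c>0$ such that for every failure probability $\delta\in(0,1)$ there is $\epsilon_0\in(0,1)$, depending only on $\delta$, for which the following holds. Let $2\le s\le d$ be integers and let $0<\epsilon\le\epsilon_0$. Let $\mathcal C$ be the class of homogeneous $s$-sparse halfspaces $x\mapsto\operatorname{sign}(w\cdot x)$, where $w\in\mathbb R^d$, $\|w\|_2=1$, and $w$ has at most $s$ nonzero coordinates; let $\mathcal D$ be the family of isotropic log-concave distributions on $\mathbb R^d$ (probability measures with a log-concave Lebesgue density, mean zero and identity covariance). Consider any (possibly randomized, computationally unbounded) active learner in the realizable case: it has free access to unlabeled instances $x_1,x_2,\dots$ drawn i.i.d. from an unknown $D\in\mathcal D$, may adaptively request the label $\operatorname{sign}(w^*\cdot x_i)$ of instances of its choice, where $w^*\in\mathcal C$ is unknown, and finally outputs a vector $w\in\mathbb R^d$. Suppose that for every $D\in\mathcal D$ and every $w^*\in\mathcal C$, with probability at least $1-\delta$ the learner halts after at most $m$ label requests with $$\operatorname{err}_D(w)=\Pr_{x\sim D}\bigl(\operatorname{sign}(w\cdot x)\ne\operatorname{sign}(w^*\cdot x)\bigr)\le\epsilon .$$ Then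 $$m\;\ge\; c\,s\Bigl(\log\frac1\epsilon+\log\frac ds\Bigr).$$ -/

import Mathlib

open MeasureTheory

noncomputable section

namespace SparseHalfspace

/-- `D` has a log-concave density with respect to Lebesgue measure: a nonnegative Borel function `f`
with `f x ^ a * f y ^ b ≤ f (a x + b y)` for all `x, y` and all weights `a, b ≥ 0`, `a + b = 1`. -/
def IsLogConcave {d : ℕ} (D : Measure (EuclideanSpace ℝ (Fin d))) : Prop :=
  ∃ f : EuclideanSpace ℝ (Fin d) → ℝ, Measurable f ∧ (∀ x, 0 ≤ f x) ∧
    (∀ x y : EuclideanSpace ℝ (Fin d), ∀ a b : ℝ, 0 ≤ a → 0 ≤ b → a + b = 1 →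
      f x ^ a * f y ^ b ≤ f (a • x + b • y)) ∧
    D = volume.withDensity (fun x => ENNReal.ofReal (f x))

/-- `D` has finite second moment, mean zero and identity covariance. -/
def IsIsotropic {d : ℕ} (D : Measure (EuclideanSpace ℝ (Fin d))) : Prop :=
  MemLp (fun x : EuclideanSpace ℝ (Fin d) => x) 2 D ∧
    ∫ x, x ∂D = 0 ∧
    ∀ u v : EuclideanSpace ℝ (Fin d), ∫ x, inner ℝ u x * inner ℝ v x ∂D = inner ℝ u v

/-- The family of isotropic log-concave probability distributions on `ℝ^d`. -/
structure IsIsotropicLogConcave {d : ℕ} (D : Measure (EuclideanSpace ℝ (Fin d))) : Prop where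
  isProbabilityMeasure : IsProbabilityMeasure D
  isLogConcave : IsLogConcave D
  isIsotropic : IsIsotropic D

/-- The concept class: (normal vectors of) homogeneous halfspaces of unit Euclidean norm with at
most `s` nonzero coordinates. -/
def sparseClass (d s : ℕ) : Set (EuclideanSpace ℝ (Fin d)) :=
  {w | ‖w‖ = 1 ∧ {i | w i ≠ 0}.ncard ≤ s}

/-- The label `sign (w · x)`; `true` stands for `+1`, `false` for `-1`, and `sign 0 = +1`. -/
def label {d : ℕ} (w x : EuclideanSpace ℝ (Fin d)) : Bool := decide (0 ≤ inner ℝ w x)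

/-- The error rate `Pr_{x ∼ D} (sign (w · x) ≠ sign (w⋆ · x))`. -/
def err {d : ℕ} (D : Measure (EuclideanSpace ℝ (Fin d))) (w wstar : EuclideanSpace ℝ (Fin d)) : ℝ :=
  D.real {x | label w x ≠ label wstar x}

/-- An active learner in `ℝ^d`, with internal randomness in `Ω` and no computational restriction.
It sees its random seed, unlabeled instances `x₀, x₁, …` and the list of all labels it has received
so far; it then either asks for the label of the instance of some index `i` (`Sum.inl i`) or halts
and outputs a halfspace `w`, given by any vector (`Sum.inr w`).

The whole infinite sequence of unlabeled instances is available from the start, so unlabeled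
instances are free. A learner that draws instances one at a time, interleaved with label requests,
is the special case in which a decision only looks at the instances drawn so far. -/
structure ActiveLearner (d : ℕ) (Ω : Type*) [MeasurableSpace Ω] where
  /-- The next action, as a function of the labels received so far (oldest first), the seed and the
  unlabeled instances. -/
  next : List Bool → Ω × (ℕ → EuclideanSpace ℝ (Fin d)) → ℕ ⊕ EuclideanSpace ℝ (Fin d)
  measurable_next : ∀ h, Measurable (next h)

namespace ActiveLearner

variable {d : ℕ} {Ω : Type*} [MeasurableSpace Ω]

/-- Continue the run of the learner after the labels `h` have been received, allowing at most `m`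
further label requests, when the instance of index `i` has label `y i`. The result is the output of
the learner, or `none` if it asks for more than `m` further labels. -/
def runFrom (L : ActiveLearner d Ω) (p : Ω × (ℕ → EuclideanSpace ℝ (Fin d))) (y : ℕ → Bool) :
    ℕ → List Bool → Option (EuclideanSpace ℝ (Fin d))
  | 0, h =>
    match L.next h p with
    | Sum.inl _ => none
    | Sum.inr w => some w
  | m + 1, h =>
    match L.next h p with
    | Sum.inl i => runFrom L p y m (h ++ [y i])
    | Sum.inr w => some w

/-- The run of the learner in the realizable case with target `wstar`: its output if it halts after
at most `m` label requests, `none` otherwise. -/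
def run (L : ActiveLearner d Ω) (wstar : EuclideanSpace ℝ (Fin d)) (m : ℕ)
    (p : Ω × (ℕ → EuclideanSpace ℝ (Fin d))) : Option (EuclideanSpace ℝ (Fin d)) :=
  L.runFrom p (fun i => label wstar (p.2 i)) m []

/-- The learner, with its seed drawn from `P`, learns the `s`-sparse halfspaces under isotropic
log-concave distributions from `m` labels: for every isotropic log-concave `D` and every target in
the class, with probability at least `1 - δ` over the seed and the i.i.d. instances from `D`, it
halts after at most `m` label requests with an output of error rate at most `ε`. -/
def Learns (L : ActiveLearner d Ω) (P : Measure Ω) (s : ℕ) (ε δ : ℝ) (m : ℕ) : Prop :=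
  ∀ D : Measure (EuclideanSpace ℝ (Fin d)), IsIsotropicLogConcave D →
    ∀ wstar ∈ sparseClass d s,
      1 - δ ≤ (P.prod (Measure.infinitePi (fun _ : ℕ => D))).real
        {p | ∃ w, L.run wstar m p = some w ∧ err D w wstar ≤ ε}

end ActiveLearner

end SparseHalfspace

end

/-!
The proof uses a single distribution, the standard Gaussian on `ℝ^d`, and a counting argument over a
packing of the class.

For a fixed seed and fixed instances, a learner that requests at most `m` labels is a binary decision
tree, so it has at most `2 ^ m` outputs (`ActiveLearner.exists_finset_outputs`). If the targets in a
finite family `W` have pairwise error rates above `2 ε`, each output is good for at most one of them.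
Integrating over seed and instances, `|W| (1 - δ) ≤ 2 ^ m` (`card_mul_le_two_pow_of_learns`).

Under the standard Gaussian, the error rate between unit normal vectors is at least a constant times
their distance (`le_err_stdGaussian`), so it remains to find many `s`-sparse unit vectors whose
pairwise distances are of order at least `ε`. Take `k = s / 2` disjoint blocks of about `d / k`
coordinates, and in each block a unit vector `√(1 - t ^ 2) e₀ + t e_j` with `t` on a grid of mesh of
order `ε`. This gives an alphabet of size `A` of order `d / (s ε)`, in which distinct letters have
distance at least the mesh. A Gilbert–Varshamov code (`exists_code`) of length `k` and minimum
Hamming distance above `k / 2` turns this into a packing of at least `A ^ (k / 2) / 2 ^ k` vectors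
(`exists_packing`). Its logarithm is of order `s (log (1 / ε) + log (d / s))` once `ε` is small; small
`ε` also absorbs the loss `log (1 / (1 - δ))`.
-/

/-! ### The standard Gaussian distribution is isotropic and log-concave -/

namespace SparseHalfspace

open ProbabilityTheory

/-- The product of copies of a finite measure on `ℝ` with density `g` has the product density. -/
lemma pi_withDensity_ofReal {ι : Type*} [Fintype ι] (g : ℝ → ℝ) (hg0 : ∀ x, 0 ≤ g x)
    (hgi : Integrable g) :
    Measure.pi (fun _ : ι => (volume : Measure ℝ).withDensity fun x => ENNReal.ofReal (g x)) =
      (volume : Measure (ι → ℝ)).withDensity fun x => ENNReal.ofReal (∏ i, g (x i)) := by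
  have : IsFiniteMeasure ((volume : Measure ℝ).withDensity fun x => ENNReal.ofReal (g x)) :=
    isFiniteMeasure_withDensity_ofReal hgi.2
  refine Measure.pi_eq fun s hs => ?_
  rw [withDensity_apply _ (MeasurableSet.univ_pi hs), volume_pi, Measure.restrict_pi_pi,
    ← ofReal_integral_eq_lintegral_ofReal
      (Integrable.fintype_prod (f := fun _ => g) fun i => hgi.restrict)
      (ae_of_all _ fun x => Finset.prod_nonneg fun i _ => hg0 _),
    integral_fintype_prod_eq_prod (fun _ => g),
    ENNReal.ofReal_prod_of_nonneg fun i _ => integral_nonneg hg0]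
  refine Finset.prod_congr rfl fun i _ => ?_
  rw [withDensity_apply _ (hs i),
    ofReal_integral_eq_lintegral_ofReal hgi.restrict (ae_of_all _ hg0)]

variable {d : ℕ}

lemma stdGaussian_eq_withDensity :
    stdGaussian (EuclideanSpace ℝ (Fin d)) = volume.withDensity fun x =>
      ENNReal.ofReal ((√(2 * Real.pi))⁻¹ ^ d * Real.exp (-‖x‖ ^ 2 / 2)) := by
  rw [← map_pi_eq_stdGaussian, gaussianReal_of_var_ne_zero 0 one_ne_zero]
  have h1 : Measure.pi (fun _ : Fin d => (volume : Measure ℝ).withDensity (gaussianPDF 0 1)) =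
      (volume : Measure (Fin d → ℝ)).withDensity fun x =>
        ENNReal.ofReal (∏ i, gaussianPDFReal 0 1 (x i)) :=
    pi_withDensity_ofReal _ (gaussianPDFReal_nonneg 0 1) (integrable_gaussianPDFReal 0 1)
  rw [h1]
  have h2 : ∀ x : Fin d → ℝ, ∏ i, gaussianPDFReal 0 1 (x i) =
      (√(2 * Real.pi))⁻¹ ^ d *
        Real.exp (-‖(WithLp.toLp 2 x : EuclideanSpace ℝ (Fin d))‖ ^ 2 / 2) := by
    intro x
    simp only [gaussianPDFReal, Finset.prod_mul_distrib, ← Real.exp_sum, EuclideanSpace.norm_sq_eq]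
    simp [Finset.sum_div, neg_div]
  simp_rw [h2]
  have hm := PiLp.volume_preserving_toLp (Fin d)
  ext s hs
  rw [Measure.map_apply (by fun_prop) hs, withDensity_apply _ hs,
    withDensity_apply _ (hs.preimage (by fun_prop)),
    ← hm.setLIntegral_comp_preimage hs (by fun_prop)]

lemma gaussian_logConcave (C : ℝ) (hC : 0 ≤ C) (x y : EuclideanSpace ℝ (Fin d)) (a b : ℝ)
    (ha : 0 ≤ a) (hb : 0 ≤ b) (hab : a + b = 1) :
    (C * Real.exp (-‖x‖ ^ 2 / 2)) ^ a * (C * Real.exp (-‖y‖ ^ 2 / 2)) ^ b ≤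
      C * Real.exp (-‖a • x + b • y‖ ^ 2 / 2) := by
  have hconv : ‖a • x + b • y‖ ^ 2 ≤ a * ‖x‖ ^ 2 + b * ‖y‖ ^ 2 := by
    have := ((convexOn_norm (convex_univ (E := EuclideanSpace ℝ (Fin d)))).pow
      (fun _ _ => norm_nonneg _) 2).2 (Set.mem_univ x) (Set.mem_univ y) ha hb hab
    simpa using this
  have hCC : C ^ a * C ^ b = C := by
    rw [← Real.rpow_add_of_nonneg hC ha hb, hab, Real.rpow_one]
  rw [Real.mul_rpow hC (Real.exp_nonneg _), Real.mul_rpow hC (Real.exp_nonneg _),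
    ← Real.exp_mul, ← Real.exp_mul, mul_mul_mul_comm, hCC, ← Real.exp_add]
  gcongr
  linarith

lemma isIsotropicLogConcave_stdGaussian :
    IsIsotropicLogConcave (stdGaussian (EuclideanSpace ℝ (Fin d))) where
  isProbabilityMeasure := inferInstance
  isLogConcave := ⟨fun x => (√(2 * Real.pi))⁻¹ ^ d * Real.exp (-‖x‖ ^ 2 / 2), by fun_prop,
    fun x => by positivity, fun x y a b => gaussian_logConcave _ (by positivity) x y a b,
    stdGaussian_eq_withDensity⟩
  isIsotropic := by
    refine ⟨IsGaussian.memLp_two_id, integral_id_stdGaussian, fun u v => ?_⟩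
    have h := covarianceBilin_apply
      (IsGaussian.memLp_two_id (μ := stdGaussian (EuclideanSpace ℝ (Fin d)))) u v
    have h0 : ∫ x, id x ∂(stdGaussian (EuclideanSpace ℝ (Fin d))) = 0 := integral_id_stdGaussian
    rw [h0, covarianceBilin_stdGaussian] at h
    simpa [innerSL_apply_apply ℝ] using h.symm

/-! ### Error rates under the standard Gaussian -/

lemma map_inner_stdGaussian {u : EuclideanSpace ℝ (Fin d)} (hu : ‖u‖ = 1) :
    (stdGaussian (EuclideanSpace ℝ (Fin d))).map (fun x => inner ℝ u x) = gaussianReal 0 1 := by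
  have h := IsGaussian.map_eq_gaussianReal (μ := stdGaussian (EuclideanSpace ℝ (Fin d)))
    (innerSL ℝ u)
  rw [integral_strongDual_stdGaussian, variance_dual_stdGaussian, innerSL_apply_norm, hu] at h
  simpa using h

lemma indepFun_inner_stdGaussian {u v : EuclideanSpace ℝ (Fin d)} (huv : inner ℝ u v = 0) :
    IndepFun (fun x => inner ℝ u x) (fun x => inner ℝ v x)
      (stdGaussian (EuclideanSpace ℝ (Fin d))) := by
  have hid : HasGaussianLaw (fun x : EuclideanSpace ℝ (Fin d) => x)
      (stdGaussian (EuclideanSpace ℝ (Fin d))) := IsGaussian.hasGaussianLaw_id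
  refine HasGaussianLaw.indepFun_of_covariance_eq_zero
    (hid.map ((innerSL ℝ u).prod (innerSL ℝ v))) ?_
  rw [← covarianceBilin_apply_eq_cov IsGaussian.memLp_two_id, covarianceBilin_stdGaussian]
  simpa [innerSL_apply_apply ℝ] using huv

/-- An interval inside `[-2, 2]` has Gaussian measure at least its length times the density
at `2`. -/
lemma le_gaussianReal_Ioo {a b : ℝ} (ha : -2 ≤ a) (hab : a ≤ b) (hb : b ≤ 2) :
    (b - a) * gaussianPDFReal 0 1 2 ≤ (gaussianReal 0 1).real (Set.Ioo a b) := by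
  rw [measureReal_def, gaussianReal_apply_eq_integral 0 one_ne_zero, ENNReal.toReal_ofReal
    (integral_nonneg fun x => gaussianPDFReal_nonneg _ _ _)]
  calc (b - a) * gaussianPDFReal 0 1 2 = ∫ _ in Set.Ioo a b, gaussianPDFReal 0 1 2 := by
        simp [measureReal_def, hab]
    _ ≤ ∫ x in Set.Ioo a b, gaussianPDFReal 0 1 x := by
        refine setIntegral_mono_on (by simp) (integrable_gaussianPDFReal 0 1).restrict
          measurableSet_Ioo fun x hx => ?_
        unfold gaussianPDFReal
        gcongr 3
        rw [neg_le_neg_iff]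
        nlinarith [hx.1, hx.2]

/-- The constant in the lower bound of the error rate by the distance of the normal vectors. -/
noncomputable def errConst : ℝ := gaussianPDFReal 0 1 2 ^ 2

lemma errConst_pos : 0 < errConst := pow_pos (gaussianPDFReal_pos 0 1 2 one_ne_zero) 2

lemma err_symm (D : Measure (EuclideanSpace ℝ (Fin d))) (v w : EuclideanSpace ℝ (Fin d)) :
    err D v w = err D w v := by
  simp only [err, ne_comm]

lemma err_triangle (D : Measure (EuclideanSpace ℝ (Fin d))) [IsFiniteMeasure D]
    (u v w : EuclideanSpace ℝ (Fin d)) : err D u w ≤ err D u v + err D v w := by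
  refine (measureReal_mono fun x hx => ?_).trans (measureReal_union_le _ _)
  by_contra h
  simp only [Set.mem_union, Set.mem_ofPred_eq, not_or, not_not] at h hx
  exact hx (h.1.trans h.2)

/-- Under the standard Gaussian, the error rate dominates the distance of the unit normal vectors.
The directions `w₁ - w₂` and `w₁ + w₂` are orthogonal, so the projections on them are independent;
the labels differ when the first is larger than the second. -/
lemma le_err_stdGaussian {w₁ w₂ : EuclideanSpace ℝ (Fin d)} (h₁ : ‖w₁‖ = 1) (h₂ : ‖w₂‖ = 1) :
    errConst * ‖w₁ - w₂‖ ≤ err (stdGaussian (EuclideanSpace ℝ (Fin d))) w₁ w₂ := by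
  set D := stdGaussian (EuclideanSpace ℝ (Fin d))
  by_cases hne : w₁ - w₂ = 0
  · simp [hne, err, measureReal_nonneg]
  set β : ℝ := ‖w₁ - w₂‖ / 2 with hβ
  have hn : 0 < ‖w₁ - w₂‖ := norm_pos_iff.2 hne
  have hβ0 : 0 < β := by positivity
  have hβ1 : β ≤ 1 := by
    have := norm_sub_le w₁ w₂
    rw [hβ]; linarith
  set u : EuclideanSpace ℝ (Fin d) := ‖w₁ - w₂‖⁻¹ • (w₁ - w₂) with hu
  set p : EuclideanSpace ℝ (Fin d) := (1 / 2 : ℝ) • (w₁ + w₂) with hp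
  have hu1 : ‖u‖ = 1 := norm_smul_inv_norm (𝕜 := ℝ) hne
  have hp1 : ‖p‖ ≤ 1 := by
    have := norm_add_le w₁ w₂
    rw [hp, norm_smul]; norm_num; linarith
  have hβu : β • u = (1 / 2 : ℝ) • (w₁ - w₂) := by
    rw [hu, smul_smul, hβ]; congr 1; field_simp
  have hw1 : w₁ = p + β • u := by rw [hβu, hp]; module
  have hw2 : w₂ = p - β • u := by rw [hβu, hp]; module
  have hup : inner ℝ u p = 0 := by
    rw [hu, hp, inner_smul_left, inner_smul_right, inner_sub_left, inner_add_right,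
      inner_add_right, real_inner_comm w₁ w₂, real_inner_self_eq_norm_sq,
      real_inner_self_eq_norm_sq, h₁, h₂]
    simp [add_comm]
  -- a unit vector in the direction of `p`, also when `p = 0`
  obtain ⟨v, hv1, hpv⟩ : ∃ v : EuclideanSpace ℝ (Fin d), ‖v‖ = 1 ∧ p = ‖p‖ • v := by
    by_cases h0 : p = 0
    · exact ⟨u, hu1, by simp [h0]⟩
    · exact ⟨‖p‖⁻¹ • p, norm_smul_inv_norm (𝕜 := ℝ) h0, by
        rw [smul_smul, mul_inv_cancel₀ (norm_ne_zero_iff.2 h0), one_smul]⟩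
  have hind := (indepFun_inner_stdGaussian hup).measure_inter_preimage_eq_mul (Set.Ioo 1 2)
    (Set.Ioo (-β) β) measurableSet_Ioo measurableSet_Ioo
  have hA : gaussianPDFReal 0 1 2 ≤ D.real ((fun x => inner ℝ u x) ⁻¹' Set.Ioo 1 2) := by
    rw [← map_measureReal_apply (by fun_prop) measurableSet_Ioo, map_inner_stdGaussian hu1]
    have := le_gaussianReal_Ioo (a := 1) (b := 2) (by norm_num) (by norm_num) le_rfl
    linarith
  have hB : ‖w₁ - w₂‖ * gaussianPDFReal 0 1 2 ≤
      D.real ((fun x => inner ℝ p x) ⁻¹' Set.Ioo (-β) β) := by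
    calc ‖w₁ - w₂‖ * gaussianPDFReal 0 1 2 = (β - -β) * gaussianPDFReal 0 1 2 := by
          rw [hβ]; ring
      _ ≤ (gaussianReal 0 1).real (Set.Ioo (-β) β) :=
          le_gaussianReal_Ioo (by linarith) (by linarith) (by linarith)
      _ = D.real ((fun x => inner ℝ v x) ⁻¹' Set.Ioo (-β) β) := by
          rw [← map_measureReal_apply (by fun_prop) measurableSet_Ioo, map_inner_stdGaussian hv1]
      _ ≤ D.real ((fun x => inner ℝ p x) ⁻¹' Set.Ioo (-β) β) := by
          refine measureReal_mono fun x hx => ?_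
          rw [Set.mem_preimage, Set.mem_Ioo, ← abs_lt] at hx ⊢
          rw [hpv, real_inner_smul_left, abs_mul, abs_norm]
          exact (mul_le_of_le_one_left (abs_nonneg _) hp1).trans_lt hx
  calc errConst * ‖w₁ - w₂‖
      = gaussianPDFReal 0 1 2 * (‖w₁ - w₂‖ * gaussianPDFReal 0 1 2) := by rw [errConst]; ring
    _ ≤ D.real ((fun x => inner ℝ u x) ⁻¹' Set.Ioo 1 2) *
          D.real ((fun x => inner ℝ p x) ⁻¹' Set.Ioo (-β) β) := by
        gcongr
        exact mul_nonneg hn.le (gaussianPDFReal_nonneg _ _ _)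
    _ = D.real ((fun x => inner ℝ u x) ⁻¹' Set.Ioo 1 2 ∩
          (fun x => inner ℝ p x) ⁻¹' Set.Ioo (-β) β) := by
        simp only [measureReal_def, hind, ENNReal.toReal_mul, D]
    _ ≤ err D w₁ w₂ := by
        refine measureReal_mono fun x hx => ?_
        simp only [Set.mem_inter_iff, Set.mem_preimage, Set.mem_Ioo] at hx
        have e1 : 0 ≤ inner ℝ w₁ x := by
          have : inner ℝ w₁ x = inner ℝ p x + β * inner ℝ u x := by
            rw [← real_inner_smul_left, ← inner_add_left, ← hw1]
          nlinarith
        have e2 : inner ℝ w₂ x < 0 := by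
          have : inner ℝ w₂ x = inner ℝ p x - β * inner ℝ u x := by
            rw [← real_inner_smul_left, ← inner_sub_left, ← hw2]
          nlinarith
        simp [label, e1, e2.not_ge]

end SparseHalfspace

/-! ### A learner with few label requests has few outputs -/

namespace SparseHalfspace

variable {d : ℕ}

lemma measurableSet_label (w : EuclideanSpace ℝ (Fin d)) :
    MeasurableSet {x | label w x = true} := by
  simp only [label, decide_eq_true_eq]
  exact measurableSet_le measurable_const (by fun_prop)

lemma measurable_err (D : Measure (EuclideanSpace ℝ (Fin d))) [SFinite D]
    (wstar : EuclideanSpace ℝ (Fin d)) : Measurable fun w => err D w wstar := by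
  have h1 : MeasurableSet {q : EuclideanSpace ℝ (Fin d) × EuclideanSpace ℝ (Fin d) |
      0 ≤ inner ℝ q.1 q.2} := measurableSet_le measurable_const (by fun_prop)
  have h2 : MeasurableSet {q : EuclideanSpace ℝ (Fin d) × EuclideanSpace ℝ (Fin d) |
      0 ≤ inner ℝ wstar q.2} := measurableSet_le measurable_const (by fun_prop)
  have h : MeasurableSet {q : EuclideanSpace ℝ (Fin d) × EuclideanSpace ℝ (Fin d) |
      label q.1 q.2 ≠ label wstar q.2} := by
    convert (h1.symmDiff h2) using 1
    ext q
    simp only [label, ne_eq, decide_eq_decide, Set.mem_symmDiff, Set.mem_ofPred_eq]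
    tauto
  exact (measurable_measure_prodMk_left h).ennreal_toReal

namespace ActiveLearner

variable {Ω : Type*} [MeasurableSpace Ω] (L : ActiveLearner d Ω)

/-- For a fixed seed and fixed instances the learner is a binary decision tree of depth at most
`m`, and its possible outputs are the leaves. -/
lemma exists_finset_outputs (p : Ω × (ℕ → EuclideanSpace ℝ (Fin d))) (m : ℕ) (h : List Bool) :
    ∃ T : Finset (EuclideanSpace ℝ (Fin d)), T.card ≤ 2 ^ m ∧
      ∀ y w, L.runFrom p y m h = some w → w ∈ T := by
  classical
  induction m generalizing h with
  | zero =>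
    rcases hn : L.next h p with i | w
    · exact ⟨∅, by simp, fun y w => by simp [runFrom, hn]⟩
    · exact ⟨{w}, by simp, fun y w => by simp [runFrom, hn, eq_comm]⟩
  | succ m ih =>
    rcases hn : L.next h p with i | w
    · obtain ⟨T₁, hc₁, h₁⟩ := ih (h ++ [true])
      obtain ⟨T₂, hc₂, h₂⟩ := ih (h ++ [false])
      refine ⟨T₁ ∪ T₂, (Finset.card_union_le _ _).trans (by rw [pow_succ]; omega), fun y w hw => ?_⟩
      simp only [runFrom, hn] at hw
      cases hy : y i
      · rw [hy] at hw
        exact Finset.mem_union_right _ (h₂ y w hw)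
      · rw [hy] at hw
        exact Finset.mem_union_left _ (h₁ y w hw)
    · exact ⟨{w}, by simpa using Nat.one_le_two_pow, fun y w => by simp [runFrom, hn, eq_comm]⟩

lemma measurableSet_runFrom (wstar : EuclideanSpace ℝ (Fin d))
    {B : Set (EuclideanSpace ℝ (Fin d))} (hB : MeasurableSet B) (m : ℕ) (h : List Bool) :
    MeasurableSet {p : Ω × (ℕ → EuclideanSpace ℝ (Fin d)) |
      ∃ w, L.runFrom p (fun i => label wstar (p.2 i)) m h = some w ∧ w ∈ B} := by
  have hhalt : MeasurableSet (L.next h ⁻¹' (Sum.inr '' B)) :=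
    L.measurable_next h hB.inr_image
  induction m generalizing h with
  | zero =>
    convert hhalt using 1
    ext p
    rcases hn : L.next h p with i | w <;> simp [runFrom, hn]
  | succ m ih =>
    have hlab : ∀ i, MeasurableSet {p : Ω × (ℕ → EuclideanSpace ℝ (Fin d)) |
        label wstar (p.2 i) = true} := fun i =>
      (by fun_prop : Measurable fun p : Ω × (ℕ → EuclideanSpace ℝ (Fin d)) => p.2 i)
        (measurableSet_label wstar)
    have hih : ∀ c : Bool, MeasurableSet {p : Ω × (ℕ → EuclideanSpace ℝ (Fin d)) |
        ∃ w, L.runFrom p (fun i => label wstar (p.2 i)) m (h ++ [c]) = some w ∧ w ∈ B} :=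
      fun c => ih _ (L.measurable_next _ hB.inr_image)
    have hreq : ∀ i, MeasurableSet (L.next h ⁻¹' (Sum.inl '' {i})) := fun i =>
      L.measurable_next h (measurableSet_singleton i).inl_image
    convert hhalt.union (MeasurableSet.iUnion fun i => (hreq i).inter
      (((hlab i).inter (hih true)).union ((hlab i).compl.inter (hih false)))) using 1
    ext p
    rcases hn : L.next h p with i | w
    · cases hl : label wstar (p.2 i) <;> simp [runFrom, hn, hl]
    · simp [runFrom, hn]

end ActiveLearner

/-- If no point lies in more than `K` of the events `S w`, `w ∈ W`, their probabilities sum to at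
most `K`. -/
lemma card_mul_le_of_multiplicity_le {α ι : Type*} [MeasurableSpace α] (μ : Measure α)
    [IsProbabilityMeasure μ] (W : Finset ι) (S : ι → Set α) (hS : ∀ w ∈ W, MeasurableSet (S w))
    (K : ℕ) (a : ℝ) (hK : ∀ p, ∃ V : Finset ι, V.card ≤ K ∧ ∀ w ∈ W, p ∈ S w → w ∈ V)
    (ha : ∀ w ∈ W, a ≤ μ.real (S w)) : W.card * a ≤ K := by
  classical
  have hi : ∀ w ∈ W, Integrable ((S w).indicator fun _ => (1 : ℝ)) μ := fun w hw =>
    (integrable_const 1).indicator (hS w hw)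
  calc (W.card : ℝ) * a = ∑ w ∈ W, a := by simp
    _ ≤ ∑ w ∈ W, μ.real (S w) := Finset.sum_le_sum ha
    _ = ∑ w ∈ W, ∫ p, (S w).indicator (fun _ => (1 : ℝ)) p ∂μ :=
        Finset.sum_congr rfl fun w hw => (integral_indicator_one (hS w hw)).symm
    _ = ∫ p, ∑ w ∈ W, (S w).indicator (fun _ => (1 : ℝ)) p ∂μ := (integral_finsetSum _ hi).symm
    _ ≤ ∫ _, (K : ℝ) ∂μ := by
        refine integral_mono (integrable_finsetSum _ hi) (integrable_const _) fun p => ?_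
        obtain ⟨V, hV, hpV⟩ := hK p
        simp only [Set.indicator_apply, Finset.sum_boole]
        exact_mod_cast (Finset.card_le_card fun w hw => by
          rw [Finset.mem_filter] at hw
          exact hpV w hw.1 hw.2).trans hV
    _ = K := by simp

/-- A learner that succeeds from `m` labels distinguishes the targets of any family with pairwise
error rates above `2 ε`, since each of its at most `2 ^ m` outputs is good for one of them only. -/
lemma card_mul_le_two_pow_of_learns {Ω : Type*} [MeasurableSpace Ω] (P : Measure Ω)
    [IsProbabilityMeasure P] (L : ActiveLearner d Ω) {s m : ℕ} {ε δ : ℝ}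
    (hL : L.Learns P s ε δ m) (D : Measure (EuclideanSpace ℝ (Fin d)))
    (hD : IsIsotropicLogConcave D) (W : Finset (EuclideanSpace ℝ (Fin d)))
    (hW : ∀ w ∈ W, w ∈ sparseClass d s)
    (hsep : ∀ v ∈ W, ∀ w ∈ W, v ≠ w → 2 * ε < err D v w) :
    W.card * (1 - δ) ≤ 2 ^ m := by
  classical
  have := hD.isProbabilityMeasure
  have := card_mul_le_of_multiplicity_le (P.prod (Measure.infinitePi fun _ : ℕ => D)) W
    (fun w => {p | ∃ v, L.run w m p = some v ∧ err D v w ≤ ε})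
    (fun w _ => L.measurableSet_runFrom w (measurable_err D w measurableSet_Iic) m [])
    (2 ^ m) (1 - δ) (fun p => ?_) (fun w hw => hL D hD w (hW w hw))
  · exact_mod_cast this
  obtain ⟨T, hT, hpT⟩ := L.exists_finset_outputs p m []
  refine ⟨W.filter fun w => p ∈ {p | ∃ v, L.run w m p = some v ∧ err D v w ≤ ε}, ?_,
    fun w hw hp => Finset.mem_filter.2 ⟨hw, hp⟩⟩
  refine (Finset.card_le_card_of_forall_subsingleton (fun w v => err D v w ≤ ε) ?_ ?_).trans hT
  · intro w hw
    obtain ⟨-, v, hv, hvw⟩ := Finset.mem_filter.1 hw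
    exact ⟨v, hpT _ v hv, hvw⟩
  · rintro v - w₁ ⟨hw₁, h₁⟩ w₂ ⟨hw₂, h₂⟩
    by_contra hne
    have h := hsep w₁ (Finset.mem_filter.1 hw₁).1 w₂ (Finset.mem_filter.1 hw₂).1 hne
    have ht := err_triangle D w₁ v w₂
    rw [err_symm D w₁ v] at ht
    linarith

end SparseHalfspace

/-! ### A packing of the sparse halfspaces -/

namespace SparseHalfspace

/-- The Gilbert–Varshamov bound: a code of maximal size with minimum distance above `r` covers all
words by its Hamming balls of radius `r`, each of which has at most `2 ^ k * |A| ^ r` elements. -/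
lemma exists_code (A : Type*) [Fintype A] [DecidableEq A] [Nonempty A] (k r : ℕ) :
    ∃ C : Finset (Fin k → A), (∀ f ∈ C, ∀ g ∈ C, f ≠ g → r < hammingDist f g) ∧
      Fintype.card A ^ k ≤ C.card * (2 ^ k * Fintype.card A ^ r) := by
  classical
  obtain ⟨C, hC, hmax⟩ := Finset.exists_max_image
    (Finset.univ.filter fun C : Finset (Fin k → A) =>
      ∀ f ∈ C, ∀ g ∈ C, f ≠ g → r < hammingDist f g) Finset.card ⟨∅, by simp⟩
  rw [Finset.mem_filter] at hC
  refine ⟨C, hC.2, ?_⟩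
  have hcover : ∀ f, ∃ c ∈ C, hammingDist f c ≤ r := by
    intro f
    by_contra! hf
    have hfC : f ∉ C := fun h => by simpa using hf f h
    have := hmax (insert f C) (by
      simp only [Finset.mem_filter, Finset.mem_univ, true_and, Finset.forall_mem_insert]
      refine ⟨⟨fun h => (h rfl).elim, fun g hg _ => hf g hg⟩, fun g hg => ⟨fun _ => ?_, hC.2 g hg⟩⟩
      rw [hammingDist_comm]
      exact hf g hg)
    rw [Finset.card_insert_of_notMem hfC] at this
    omega
  let ball (c : Fin k → A) : Finset (Fin k → A) :=
    (Finset.univ.filter fun S : Finset (Fin k) => S.card ≤ r).biUnion fun S =>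
      Fintype.piFinset fun i => if i ∈ S then Finset.univ else {c i}
  have hball : ∀ c, (ball c).card ≤ 2 ^ k * Fintype.card A ^ r := by
    intro c
    refine (Finset.card_biUnion_le_card_mul _ _ (Fintype.card A ^ r) fun S hS => ?_).trans
      (Nat.mul_le_mul_right _ ((Finset.card_filter_le _ _).trans (by simp)))
    rw [Fintype.card_piFinset]
    calc ∏ i, (if i ∈ S then (Finset.univ : Finset A) else {c i}).card
        = ∏ i, if i ∈ S then Fintype.card A else 1 := by
          refine Finset.prod_congr rfl fun i _ => ?_
          split_ifs <;> simp
      _ = Fintype.card A ^ S.card := by simp [Finset.prod_ite_mem]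
      _ ≤ Fintype.card A ^ r := Nat.pow_le_pow_right Fintype.card_pos (by simpa using hS)
  calc Fintype.card A ^ k = (Finset.univ : Finset (Fin k → A)).card := by simp
    _ ≤ (C.biUnion ball).card := by
        refine Finset.card_le_card fun f _ => ?_
        obtain ⟨c, hc, hfc⟩ := hcover f
        simp only [ball, Finset.mem_biUnion, Finset.mem_filter, Finset.mem_univ, true_and,
          Fintype.mem_piFinset]
        refine ⟨c, hc, Finset.univ.filter fun i => f i ≠ c i, hfc, fun i => ?_⟩
        by_cases h : f i = c i <;> simp [h]
    _ ≤ C.card * (2 ^ k * Fintype.card A ^ r) := Finset.card_biUnion_le_card_mul _ _ _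
        fun c _ => hball c

/-- The height `(i + 1) / Q` of a letter: one of `Q` equally spaced points of `(0, 1]`. -/
noncomputable def letterHeight {n Q : ℕ} (a : Fin n × Fin Q) : ℝ := ((a.2 : ℝ) + 1) / Q

/-- The block of coordinates that encodes the letter `a = (j, i)`: the unit vector
`√(1 - t ^ 2) e₀ + t e_{j + 1}` with `t = (i + 1) / Q`. -/
noncomputable def letterVec {n Q : ℕ} (a : Fin n × Fin Q) : Fin (n + 1) → ℝ :=
  Fin.cons √(1 - letterHeight a ^ 2) (Pi.single a.1 (letterHeight a))

variable {n Q : ℕ}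

lemma one_div_le_letterHeight (a : Fin n × Fin Q) : 1 / (Q : ℝ) ≤ letterHeight a := by
  unfold letterHeight
  gcongr
  simp

lemma letterHeight_le_one (a : Fin n × Fin Q) : letterHeight a ≤ 1 := by
  unfold letterHeight
  refine div_le_one_of_le₀ ?_ (by positivity)
  exact_mod_cast a.2.isLt

lemma sum_letterVec_sq (a : Fin n × Fin Q) : ∑ l, letterVec a l ^ 2 = 1 := by
  have h0 : 0 ≤ letterHeight a := le_trans (by positivity) (one_div_le_letterHeight a)
  have h1 := letterHeight_le_one a
  rw [Fin.sum_univ_succ]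
  simp only [letterVec, Fin.cons_zero, Fin.cons_succ]
  rw [Real.sq_sqrt (by nlinarith), Finset.sum_eq_single a.1]
  · simp
  · intro j _ hj
    simp [hj]
  · simp

lemma letterVec_eq_zero (a : Fin n × Fin Q) {l : Fin (n + 1)} (h0 : l ≠ 0) (h1 : l ≠ a.1.succ) :
    letterVec a l = 0 := by
  obtain ⟨j, rfl⟩ := Fin.exists_succ_eq.2 h0
  have : j ≠ a.1 := fun h => h1 (by rw [h])
  simp [letterVec, this]

lemma le_sum_letterVec_sub_sq {a b : Fin n × Fin Q} (hab : a ≠ b) :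
    (1 / (Q : ℝ)) ^ 2 ≤ ∑ l, (letterVec a l - letterVec b l) ^ 2 := by
  have hle : |1 / (Q : ℝ)| ≤ |letterVec a a.1.succ - letterVec b a.1.succ| := by
    rw [abs_of_nonneg (by positivity : (0 : ℝ) ≤ 1 / Q)]
    simp only [letterVec, Fin.cons_succ, Pi.single_eq_same]
    by_cases h : a.1 = b.1
    · have h2 : (a.2 : ℤ) ≠ b.2 := fun h2 => hab (Prod.ext h (Fin.ext (by exact_mod_cast h2)))
      have h3 : (1 : ℝ) ≤ |(a.2 : ℝ) - b.2| := by
        exact_mod_cast Int.one_le_abs (sub_ne_zero.2 h2)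
      rw [h, Pi.single_eq_same, letterHeight, letterHeight, ← sub_div, abs_div,
        abs_of_nonneg (by positivity : (0 : ℝ) ≤ Q)]
      gcongr
      simpa using h3
    · rw [Pi.single_eq_of_ne h, sub_zero]
      exact (one_div_le_letterHeight a).trans (le_abs_self _)
  exact (sq_le_sq.2 hle).trans (Finset.single_le_sum
    (f := fun l => (letterVec a l - letterVec b l) ^ 2) (fun _ _ => sq_nonneg _)
    (Finset.mem_univ _))

variable {d k : ℕ}

/-- The vector that encodes the word `f`: in each of the `k` disjoint blocks of coordinates given by
`e`, the vector of the corresponding letter, scaled by `1 / √k`. -/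
noncomputable def wordVec (e : Fin k × Fin (n + 1) ↪ Fin d) (f : Fin k → Fin n × Fin Q) :
    EuclideanSpace ℝ (Fin d) :=
  WithLp.toLp 2 (Function.extend e (fun q => letterVec (f q.1) q.2 / √k) 0)

lemma norm_sq_toLp_extend {ι : Type*} [Fintype ι] (e : ι ↪ Fin d) (g : ι → ℝ) :
    ‖(WithLp.toLp 2 (Function.extend e g 0) : EuclideanSpace ℝ (Fin d))‖ ^ 2 = ∑ q, g q ^ 2 := by
  rw [EuclideanSpace.norm_sq_eq]
  simp only [Real.norm_eq_abs, sq_abs]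
  rw [← Finset.sum_subset (Finset.subset_univ (Finset.univ.map e)), Finset.sum_map]
  · simp [e.injective.extend_apply]
  · intro i _ hi
    rw [Function.extend_apply']
    · simp
    · simpa using hi

lemma norm_wordVec (hk : 0 < k) (e : Fin k × Fin (n + 1) ↪ Fin d)
    (f : Fin k → Fin n × Fin Q) : ‖wordVec e f‖ = 1 := by
  have hk' : (0 : ℝ) < k := by exact_mod_cast hk
  rw [← sq_eq_sq₀ (norm_nonneg _) zero_le_one, wordVec, norm_sq_toLp_extend, Fintype.sum_prod_type]
  simp only [div_pow, Real.sq_sqrt hk'.le, ← Finset.sum_div, sum_letterVec_sq]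
  simp [hk'.ne']

lemma ncard_support_wordVec_le (e : Fin k × Fin (n + 1) ↪ Fin d)
    (f : Fin k → Fin n × Fin Q) : {i | wordVec e f i ≠ 0}.ncard ≤ 2 * k := by
  have hsub : {i | wordVec e f i ≠ 0} ⊆
      Set.range fun q : Fin k × Bool => e (q.1, if q.2 then 0 else (f q.1).1.succ) := by
    intro i hi
    by_cases h : ∃ q, e q = i
    · obtain ⟨⟨a, l⟩, rfl⟩ := h
      by_cases h0 : l = 0
      · exact ⟨(a, true), by simp [h0]⟩
      by_cases h1 : l = (f a).1.succ
      · exact ⟨(a, false), by simp [h1]⟩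
      refine (hi ?_).elim
      simp [wordVec, e.injective.extend_apply, letterVec_eq_zero _ h0 h1]
    · exact (hi (by simp [wordVec, Function.extend_apply' _ _ _ h])).elim
  refine (Set.ncard_le_ncard hsub (Set.finite_range _)).trans ?_
  rw [← Set.image_univ]
  refine (Set.ncard_image_le Set.finite_univ).trans ?_
  rw [Set.ncard_univ, Nat.card_eq_fintype_card]
  simp [mul_comm]

lemma le_norm_wordVec_sub (hk : 0 < k) (e : Fin k × Fin (n + 1) ↪ Fin d)
    {f g : Fin k → Fin n × Fin Q} (hfg : k / 2 < hammingDist f g) :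
    1 / (2 * (Q : ℝ)) ≤ ‖wordVec e f - wordVec e g‖ := by
  have hk' : (0 : ℝ) < k := by exact_mod_cast hk
  have hsub : wordVec e f - wordVec e g = WithLp.toLp 2 (Function.extend e
      (fun q => (letterVec (f q.1) q.2 - letterVec (g q.1) q.2) / √k) 0) := by
    rw [wordVec, wordVec, ← WithLp.toLp_sub]
    congr 1
    funext i
    by_cases h : ∃ q, e q = i
    · obtain ⟨q, rfl⟩ := h
      simp [e.injective.extend_apply, sub_div]
    · simp [Function.extend_apply' _ _ _ h]
  have hham : (k : ℝ) ≤ 2 * hammingDist f g := by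
    have : k ≤ 2 * hammingDist f g := by omega
    exact_mod_cast this
  refine le_of_sq_le_sq ?_ (norm_nonneg _)
  rw [hsub, norm_sq_toLp_extend, Fintype.sum_prod_type]
  simp only [div_pow _ (√(k : ℝ)), Real.sq_sqrt hk'.le, ← Finset.sum_div]
  calc (1 / (2 * (Q : ℝ))) ^ 2 = 1 / 4 * (1 / (Q : ℝ)) ^ 2 := by
        rw [one_div, one_div, mul_inv]; ring
    _ ≤ hammingDist f g / k * (1 / (Q : ℝ)) ^ 2 := by
        refine mul_le_mul_of_nonneg_right ?_ (sq_nonneg _)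
        rw [le_div_iff₀ hk']
        linarith
    _ = (∑ a with f a ≠ g a, (1 / (Q : ℝ)) ^ 2) / k := by
        rw [Finset.sum_const, nsmul_eq_mul, hammingDist]; ring
    _ ≤ (∑ a, ∑ l, (letterVec (f a) l - letterVec (g a) l) ^ 2) / k := by
        gcongr
        refine (Finset.sum_le_sum fun a ha => le_sum_letterVec_sub_sq
          (Finset.mem_filter.1 ha).2).trans ?_
        exact Finset.sum_le_sum_of_subset_of_nonneg (Finset.filter_subset _ _) fun a _ _ =>
          Finset.sum_nonneg fun _ _ => sq_nonneg _

/-- A packing of the class: `k` blocks of `n + 1` coordinates, with two nonzero coordinates each,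
and code words with Hamming distance above `k / 2`. -/
lemma exists_packing {s : ℕ} (hk : 0 < k) (hs : 2 * k ≤ s) (hd : k * (n + 1) ≤ d) (hn : 0 < n)
    (hQ : 0 < Q) :
    ∃ W : Finset (EuclideanSpace ℝ (Fin d)), (∀ w ∈ W, w ∈ sparseClass d s) ∧
      (∀ v ∈ W, ∀ w ∈ W, v ≠ w → 1 / (2 * (Q : ℝ)) ≤ ‖v - w‖) ∧
      (n * Q) ^ k ≤ W.card * (2 ^ k * (n * Q) ^ (k / 2)) := by
  classical
  have : Nonempty (Fin n) := ⟨⟨0, hn⟩⟩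
  have : Nonempty (Fin Q) := ⟨⟨0, hQ⟩⟩
  obtain ⟨C, hC, hcard⟩ := exists_code (Fin n × Fin Q) k (k / 2)
  obtain ⟨e⟩ : Nonempty (Fin k × Fin (n + 1) ↪ Fin d) :=
    Function.Embedding.nonempty_of_card_le (by simpa using hd)
  have hdist : ∀ f ∈ C, ∀ g ∈ C, f ≠ g → 1 / (2 * (Q : ℝ)) ≤ ‖wordVec e f - wordVec e g‖ :=
    fun f hf g hg hfg => le_norm_wordVec_sub hk e (hC f hf g hg hfg)
  have hQ' : (0 : ℝ) < 1 / (2 * (Q : ℝ)) := by positivity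
  have hinj : Set.InjOn (wordVec e) (C : Set (Fin k → Fin n × Fin Q)) := by
    intro f hf g hg hfg
    by_contra hne
    have := hdist f hf g hg hne
    rw [hfg, sub_self, norm_zero] at this
    linarith
  refine ⟨C.image (wordVec e), ?_, ?_, ?_⟩
  · simp only [Finset.forall_mem_image]
    exact fun f _ => ⟨norm_wordVec hk e f, (ncard_support_wordVec_le e f).trans hs⟩
  · simp only [Finset.forall_mem_image]
    exact fun f hf g hg hne => hdist f hf g hg fun h => hne (by rw [h])
  · rw [Finset.card_image_of_injOn hinj]
    simpa using hcard

end SparseHalfspace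

/-! ### The label complexity -/

namespace SparseHalfspace

/-- The number of labels in terms of the alphabet size `A`, the block number `k` and the packing
size `N`. -/
lemma half_mul_log_le {A k N m : ℕ} {δ : ℝ} (hA : 0 < A) (hδ : δ < 1)
    (hN : A ^ k ≤ N * (2 ^ k * A ^ (k / 2))) (hm : N * (1 - δ) ≤ 2 ^ m) :
    (k : ℝ) / 2 * (Real.log A - 2 * Real.log 2) ≤ m * Real.log 2 + Real.log (1 / (1 - δ)) := by
  have hA' : (1 : ℝ) ≤ A := by exact_mod_cast hA
  have hN0 : 0 < N := by
    rcases Nat.eq_zero_or_pos N with rfl | h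
    · simp [hA.ne'] at hN
    · exact h
  have hN' : (0 : ℝ) < N := by exact_mod_cast hN0
  have h1 : (A : ℝ) ^ k ≤ N * (2 ^ k * A ^ (k / 2)) := by exact_mod_cast hN
  have h2 := Real.log_le_log (by positivity) h1
  rw [Real.log_mul (by positivity) (by positivity), Real.log_mul (by positivity) (by positivity),
    Real.log_pow, Real.log_pow, Real.log_pow] at h2
  have h3 := Real.log_le_log (mul_pos hN' (sub_pos.2 hδ)) hm
  rw [Real.log_mul hN'.ne' (sub_pos.2 hδ).ne', Real.log_pow] at h3
  have h4 : ((k / 2 : ℕ) : ℝ) * Real.log A ≤ k / 2 * Real.log A :=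
    mul_le_mul_of_nonneg_right Nat.cast_div_le (Real.log_nonneg hA')
  rw [one_div, Real.log_inv]
  linarith

/-- Block number `k`, block length `n + 1` and letter resolution `Q` of the packing, with an alphabet
of size `n * Q` of order `d / (s * ε)`. -/
lemma exists_packing_parameters {d s : ℕ} (hs : 2 ≤ s) (hsd : s ≤ d) {ε κ : ℝ} (hε : 0 < ε)
    (hκ : 8 * ε ≤ κ) :
    ∃ k n Q : ℕ, 0 < k ∧ 2 * k ≤ s ∧ s ≤ 3 * k ∧ k * (n + 1) ≤ d ∧ 0 < n ∧ 0 < Q ∧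
      8 * ε * Q ≤ κ ∧ κ / 32 * (1 / ε * (d / s)) ≤ ((n * Q : ℕ) : ℝ) := by
  have hk : 0 < s / 2 := by omega
  have hb : 2 ≤ d / (s / 2) := (Nat.le_div_iff_mul_le hk).2 (by omega)
  obtain ⟨n, hn⟩ : ∃ n, d / (s / 2) = n + 1 := ⟨d / (s / 2) - 1, by omega⟩
  have hn0 : 0 < n := by omega
  have hkd : s / 2 * (n + 1) ≤ d := hn ▸ Nat.mul_div_le d (s / 2)
  have hdk : d < s / 2 * (n + 1 + 1) := by
    rw [← hn]; exact Nat.lt_mul_div_succ d hk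
  have hdn : d ≤ 2 * s * n := by
    have h1 : s / 2 * (n + 1 + 1) ≤ s / 2 * (4 * n) := Nat.mul_le_mul_left _ (by omega)
    have h2 : s / 2 * 2 * (2 * n) ≤ s * (2 * n) := Nat.mul_le_mul_right _ (Nat.div_mul_le_self s 2)
    nlinarith
  have hx : 1 ≤ κ / (8 * ε) := by rw [le_div_iff₀ (by positivity)]; linarith
  have hQ0 : 0 < ⌊κ / (8 * ε)⌋₊ := Nat.floor_pos.2 hx
  refine ⟨s / 2, n, ⌊κ / (8 * ε)⌋₊, hk, by omega, by omega, hkd, hn0, hQ0, ?_, ?_⟩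
  · have h := Nat.floor_le (zero_le_one.trans hx)
    rwa [le_div_iff₀' (by positivity)] at h
  · have hQ1 : (1 : ℝ) ≤ (⌊κ / (8 * ε)⌋₊ : ℝ) := by exact_mod_cast hQ0
    have hQ2 : κ / (16 * ε) ≤ (⌊κ / (8 * ε)⌋₊ : ℝ) := by
      have h := Nat.lt_floor_add_one (κ / (8 * ε))
      have h' : κ / (16 * ε) = κ / (8 * ε) / 2 := by rw [div_div]; ring_nf
      rw [h']; linarith
    have hs0 : (0 : ℝ) < s := by exact_mod_cast (by omega : 0 < s)
    have hn' : (d : ℝ) / (2 * s) ≤ n := by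
      rw [div_le_iff₀ (by positivity), mul_comm]
      exact_mod_cast hdn
    have hκ0 : 0 < κ := by linarith
    calc κ / 32 * (1 / ε * (d / s)) = d / (2 * s) * (κ / (16 * ε)) := by
          field_simp; ring
      _ ≤ n * (⌊κ / (8 * ε)⌋₊ : ℝ) := by gcongr
      _ = _ := by push_cast; rfl

/-- The lower bound on the number of labels, up to lower order terms. -/
lemma le_labels_of_learns {d s m : ℕ} (hs : 2 ≤ s) (hsd : s ≤ d) {ε δ : ℝ} (hε : 0 < ε)
    (hεc : 8 * ε ≤ errConst) (hδ : δ < 1) {Ω : Type*} [MeasurableSpace Ω] (P : Measure Ω)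
    [IsProbabilityMeasure P] (L : ActiveLearner d Ω) (hL : L.Learns P s ε δ m) :
    ∃ k : ℕ, s ≤ 3 * k ∧ (k : ℝ) / 2 * (Real.log (1 / ε) + Real.log (d / s) -
      Real.log (128 / errConst)) ≤ m + Real.log (1 / (1 - δ)) := by
  have hc := errConst_pos
  obtain ⟨k, n, Q, hk, hks, hsk, hd, hn, hQ, hQε, hA⟩ := exists_packing_parameters hs hsd hε hεc
  obtain ⟨W, hW, hdist, hcard⟩ := exists_packing (Q := Q) hk hks hd hn hQ
  have hQ' : (0 : ℝ) < Q := by exact_mod_cast hQ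
  have hm := card_mul_le_two_pow_of_learns P L hL _ isIsotropicLogConcave_stdGaussian W hW
    fun v hv w hw hne => by
      calc 2 * ε < 4 * ε := by linarith
        _ ≤ errConst * (1 / (2 * (Q : ℝ))) := by
            rw [mul_one_div, le_div_iff₀ (by positivity)]; linarith
        _ ≤ errConst * ‖v - w‖ := by gcongr; exact hdist v hv w hw hne
        _ ≤ _ := le_err_stdGaussian (hW v hv).1 (hW w hw).1
  refine ⟨k, hsk, ?_⟩
  have hs0 : (0 : ℝ) < s := by exact_mod_cast (by omega : 0 < s)
  have hd0 : (0 : ℝ) < d := by exact_mod_cast (by omega : 0 < d)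
  have hlog := Real.log_le_log (by positivity) hA
  rw [Real.log_mul (by positivity) (by positivity), Real.log_mul (by positivity) (by positivity),
    Real.log_div hc.ne' (by norm_num)] at hlog
  have h128 : Real.log (128 / errConst) = Real.log 32 + 2 * Real.log 2 - Real.log errConst := by
    rw [Real.log_div (by norm_num) hc.ne', show (128 : ℝ) = 32 * 2 ^ 2 by norm_num,
      Real.log_mul (by norm_num) (by norm_num), Real.log_pow]
    norm_num
  have hmain := half_mul_log_le (Nat.mul_pos hn hQ) hδ hcard hm
  have hlog2 : (m : ℝ) * Real.log 2 ≤ m :=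
    mul_le_of_le_one_right (Nat.cast_nonneg m) (by linarith [Real.log_two_lt_d9])
  have hstep : (k : ℝ) / 2 * (Real.log (1 / ε) + Real.log (d / s) - Real.log (128 / errConst)) ≤
      (k : ℝ) / 2 * (Real.log ((n * Q : ℕ) : ℝ) - 2 * Real.log 2) := by
    gcongr ?_ * ?_
    linarith
  linarith

end SparseHalfspace

theorem mainTheorem10 :
    ∃ c : ℝ, 0 < c ∧ ∀ δ : ℝ, 0 < δ → δ < 1 → ∃ ε₀ : ℝ, 0 < ε₀ ∧ ε₀ < 1 ∧
      ∀ (d s : ℕ), 2 ≤ s → s ≤ d → ∀ ε : ℝ, 0 < ε → ε ≤ ε₀ →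
      ∀ (Ω : Type*) [MeasurableSpace Ω] (P : Measure Ω) [IsProbabilityMeasure P]
        (L : SparseHalfspace.ActiveLearner d Ω) (m : ℕ), L.Learns P s ε δ m →
        c * ((s : ℝ) * (Real.log (1 / ε) + Real.log ((d : ℝ) / (s : ℝ)))) ≤ (m : ℝ) := by
  refine ⟨1 / 24, by norm_num, fun δ hδ0 hδ1 => ?_⟩
  set C : ℝ := Real.log (128 / SparseHalfspace.errConst) with hC
  set Λ : ℝ := Real.log (1 / (1 - δ)) with hΛ
  have hc := SparseHalfspace.errConst_pos
  have hΛ0 : 0 ≤ Λ := Real.log_nonneg (by rw [le_div_iff₀ (by linarith)]; linarith)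
  have hCabs := le_abs_self C
  have hC0 := abs_nonneg C
  -- `log (1 / ε₀)` exceeds `2 C` and `12 Λ`, which absorbs the lower order terms
  refine ⟨Real.exp (-(2 * |C| + 12 * Λ + 1)), Real.exp_pos _,
    by rw [Real.exp_lt_one_iff]; linarith, ?_⟩
  intro d s hs hsd ε hε hεε₀ Ω _ P _ L m hL
  have hlogε : 2 * |C| + 12 * Λ + 1 ≤ Real.log (1 / ε) := by
    have h := Real.log_le_log hε hεε₀
    rw [Real.log_exp] at h
    rw [one_div, Real.log_inv]
    linarith
  have hεc : 8 * ε ≤ SparseHalfspace.errConst := by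
    have h : C ≤ Real.log (1 / ε) := by linarith
    rw [hC, Real.log_le_log_iff (by positivity) (by positivity), div_le_div_iff₀ hc hε] at h
    linarith
  have hds : 0 ≤ Real.log ((d : ℝ) / s) := by
    refine Real.log_nonneg ?_
    rw [le_div_iff₀ (by exact_mod_cast (by omega : 0 < s)), one_mul]
    exact_mod_cast hsd
  obtain ⟨k, hsk, hk⟩ := SparseHalfspace.le_labels_of_learns hs hsd hε hεc hδ1 P L hL
  set X : ℝ := Real.log (1 / ε) + Real.log ((d : ℝ) / s)
  have hX : 2 * |C| + 12 * Λ + 1 ≤ X := by linarith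
  have hsk' : (s : ℝ) ≤ 3 * k := by exact_mod_cast hsk
  have hs' : (2 : ℝ) ≤ s := by exact_mod_cast hs
  have h1 : (k : ℝ) / 2 * (X / 2) ≤ k / 2 * (X - C) := by
    gcongr ?_ * ?_
    linarith
  have h2 : (s : ℝ) * X ≤ 3 * k * X := by gcongr; linarith
  have h3 : 2 * X ≤ s * X := by gcongr; linarith
  linarith
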